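/- Let $m\ge 1$ and consider the integro-differential equation $$\dot x(t)+a(t)x(t)+\sum_{l=1}^m b_l(t)\int_{h_l(t)}^t K_l(t,s)\,x(s)\,ds=0 ,\qquad t\ge 0, \tag{E}$$ under the following assumptions. * $a,b_1,\dots,b_m$ are Lebesgue measurable and essentially bounded on $[0,\infty)$, $a(t)\ge a_0>0$ for some constant $a_0$, and $b_l(t)\ge 0$ (almost everywhere). * Each $h_l$ is Lebesgue measurable, $h_l(t)\le t$ for $t\ge 0$, and $\lim_{t\to\infty}h_l(t)=\infty$. * Each $K_l$ is Lebesgue measurable, nonnegative and essentially bounded on $\{(t,s): t\ge 0,\ h_l(t)\le s\le t\}$, and $\int_{h_l(t)}^t K_l(t,s)\,ds=1$ for almost all $t\ge 0$. * $\displaystyle h_0:=\limsup_{t\to\infty}\int_{\min_l h_l(t)}^t a(s)\,ds<\infty .$ * With $\displaystyle \beta:=\limsup_{t\to\infty}\frac{\sum_{l=1}^m b_l(t)}{a(t)}$ (upper limit up to null sets), $$\frac1\beta\, e^{-h_0}>\ln\frac{\beta^2+\beta}{\beta^2+1},$$ where the inequality is regarded as satisfied if $\beta=0$. Then (E) is exponentially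 stable: there exist $M>0$ and $\alpha>0$ such that for every $t_0\ge 0$, every bounded Borel measurable $\varphi:(-\infty,t_0]\to\mathbb R$, and every solution $x$ of the initial value problem at $t_0$ (that is, $x$ is locally absolutely continuous on $[t_0,\infty)$, satisfies (E) for almost every $t\ge t_0$, and $x(t)=\varphi(t)$ for $t\le t_0$), $$|x(t)|\le M\,\Big(\sup_{s\le t_0}|\varphi(s)|\Big)\,e^{-\alpha (t-t_0)},\qquad t\ge t_0 .$$ -/

import Mathlib

open MeasureTheory Set Filter

noncomputable section

/-- `f` is Lebesgue measurable and essentially bounded on `[0, ∞)`. -/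
def EssBoundedMeasurable (f : ℝ → ℝ) : Prop :=
  AEMeasurable f (volume.restrict (Ici 0)) ∧
    ∃ C : ℝ, ∀ᵐ t ∂(volume.restrict (Ici 0)), |f t| ≤ C

/-- `h` is a delay function on `[0, ∞)`: it is Lebesgue measurable, `h t ≤ t` for `t ≥ 0`, and
`h t → ∞` as `t → ∞`. -/
def IsDelay (h : ℝ → ℝ) : Prop :=
  AEMeasurable h (volume.restrict (Ici 0)) ∧ (∀ t, 0 ≤ t → h t ≤ t) ∧ Tendsto h atTop atTop

/-- The set of pairs `(t, s)` with `t ≥ 0` and `h t ≤ s ≤ t`, on which a kernel is defined. -/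
def kernelDomain (h : ℝ → ℝ) : Set (ℝ × ℝ) :=
  {p | 0 ≤ p.1 ∧ h p.1 ≤ p.2 ∧ p.2 ≤ p.1}

/-- `K` is a Lebesgue measurable, nonnegative, essentially bounded kernel with
`∫_{h(t)}^t K(t,s) ds = 1` for almost all `t ≥ 0`. -/
def IsUnitKernel (h : ℝ → ℝ) (K : ℝ → ℝ → ℝ) : Prop :=
  AEMeasurable (Function.uncurry K) (volume.restrict (kernelDomain h)) ∧
    (∀ᵐ p ∂(volume.restrict (kernelDomain h)), 0 ≤ K p.1 p.2) ∧
    (∃ C : ℝ, ∀ᵐ p ∂(volume.restrict (kernelDomain h)), K p.1 p.2 ≤ C) ∧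
    ∀ᵐ t ∂(volume.restrict (Ici 0)), ∫ s in (h t)..t, K t s = 1

/-- `φ` is a bounded Borel measurable function on `(-∞, t₀]`. -/
def IsInitialFunction (t₀ : ℝ) (φ : ℝ → ℝ) : Prop :=
  Measurable (fun s : Iic t₀ => φ s) ∧ ∃ C : ℝ, ∀ s, s ≤ t₀ → |φ s| ≤ C

/-- `x` solves
`x'(t) + a(t) x(t) + ∑ l, b_l(t) ∫_{h_l(t)}^t K_l(t,s) x(s) ds = 0` for `t ≥ t₀`,
`x(t) = φ(t)` for `t ≤ t₀`: it is (locally) absolutely continuous on `[t₀, ∞)`,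
satisfies the equation almost everywhere there, and equals `φ` on `(-∞, t₀]`. -/
def IsSolution {m : ℕ} (a : ℝ → ℝ) (b h : Fin m → ℝ → ℝ) (K : Fin m → ℝ → ℝ → ℝ)
    (t₀ : ℝ) (φ x : ℝ → ℝ) : Prop :=
  (∀ T, t₀ ≤ T → AbsolutelyContinuousOnInterval x t₀ T) ∧
    (∀ᵐ t ∂(volume.restrict (Ici t₀)), ∃ x' : ℝ, HasDerivAt x x' t ∧
      x' + a t * x t + ∑ l, b l t * ∫ s in (h l t)..t, K l t s * x s = 0) ∧
    ∀ t, t ≤ t₀ → x t = φ t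

/-- Exponential stability of the integro-differential equation: the solutions of all initial value
problems with initial point `t₀ ≥ 0` and a bounded Borel initial function `φ` satisfy
`|x t| ≤ M ‖φ‖ exp (-α (t - t₀))` for `t ≥ t₀`, where `‖φ‖` is the sup-norm over `(-∞, t₀]` and
`M, α > 0` depend neither on `φ` nor on `t₀`. -/
def ExponentiallyStable {m : ℕ} (a : ℝ → ℝ) (b h : Fin m → ℝ → ℝ)
    (K : Fin m → ℝ → ℝ → ℝ) : Prop :=
  ∃ M > 0, ∃ α > 0, ∀ t₀ : ℝ, 0 ≤ t₀ → ∀ φ x : ℝ → ℝ, IsInitialFunction t₀ φ →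
    IsSolution a b h K t₀ φ x → ∀ t, t₀ ≤ t →
      |x t| ≤ M * (⨆ s : Iic t₀, |φ s|) * Real.exp (-α * (t - t₀))

/-- The function `t ↦ ∫_{min_l h_l(t)}^t a(s) ds`. -/
def delayIntegral {m : ℕ} (a : ℝ → ℝ) (h : Fin m → ℝ → ℝ) (t : ℝ) : ℝ :=
  ∫ s in (⨅ l, h l t)..t, a s

/-- `h₀ = limsup_{t → ∞} ∫_{min_l h_l(t)}^t a(s) ds`. This is the true upper limit when the
function is bounded above near infinity. -/
def limsupDelay {m : ℕ} (a : ℝ → ℝ) (h : Fin m → ℝ → ℝ) : ℝ :=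
  limsup (delayIntegral a h) atTop

/-- `β = limsup_{t → ∞} (∑ l, b_l(t)) / a(t)`. As `a` and the `b_l` are given up to null sets, the
upper limit is the essential one: `atTop ⊓ ae volume` is the filter of the sets that contain almost
every point of some half-line `[T, ∞)`. -/
def limsupRatio {m : ℕ} (a : ℝ → ℝ) (b : Fin m → ℝ → ℝ) : ℝ :=
  limsup (fun t => (∑ l, b l t) / a t) (atTop ⊓ ae volume)

end

/-!
Measure time by the clock `A = ∫ a`, in which the delays are at most `H`, slightly more than `h₀`,
from some time on, and the delayed term is at most `β` times the maximum of the past solution. As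
the criterion is strict, it survives the passage from `x` to `z = e ^ (α A) x` for a small `α > 0`,
and exponential decay becomes boundedness of `z`.

Suppose that `|z|` reaches a new maximum `S = z t` at a late time `t`. Since `z` decreases while
its whole memory is nonnegative, the last zero `ξ` of `z` before `t` lies at most `H` units of `A`
back. Going backwards from `ξ`, `-z` is at most `β S (e ^ (A ξ - A s) - 1)`. Now integrate from `ξ`
to `t`, bounding the values of `-z` under the delayed integral by `S` at first and by this estimate
from `switchTime` on: the criterion says that the resulting bound for `z t` is less than `S`,
whatever the length of the interval up to `H`. Hence `|z|` never exceeds its early bound.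
-/

theorem absolutelyContinuousOnInterval_lipschitzOnWith_comp {E F : Type*} [PseudoMetricSpace E]
    [PseudoMetricSpace F] {g : E → F} {f : ℝ → E} {s : Set E} {L : NNReal} {p q : ℝ}
    (hg : LipschitzOnWith L g s) (hf : AbsolutelyContinuousOnInterval f p q)
    (hfs : MapsTo f (uIcc p q) s) : AbsolutelyContinuousOnInterval (g ∘ f) p q := by
  have hlim := Tendsto.const_mul (L : ℝ) hf
  rw [mul_zero] at hlim
  refine squeeze_zero' (Eventually.of_forall fun _ => Finset.sum_nonneg fun _ _ => dist_nonneg)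
    ?_ hlim
  refine eventually_inf_principal.2 (Eventually.of_forall fun I hI => ?_)
  rw [Finset.mul_sum]
  exact Finset.sum_le_sum fun i hi =>
    hg.dist_le_mul _ (hfs (hI.left i hi).1) _ (hfs (hI.left i hi).2)

theorem absolutelyContinuousOnInterval_exp_comp {f : ℝ → ℝ} {p q : ℝ}
    (hf : AbsolutelyContinuousOnInterval f p q) :
    AbsolutelyContinuousOnInterval (fun t => Real.exp (f t)) p q := by
  obtain ⟨C, hC⟩ := hf.exists_bound
  have hexp : ContDiffOn ℝ 1 Real.exp (Icc (-C) C) := Real.contDiff_exp.contDiffOn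
  obtain ⟨L, hL⟩ := hexp.exists_lipschitzOnWith one_ne_zero (convex_Icc _ _) isCompact_Icc
  have hmaps : MapsTo f (uIcc p q) (Icc (-C) C) := fun t ht => abs_le.1 (hC t ht)
  exact absolutelyContinuousOnInterval_lipschitzOnWith_comp (g := Real.exp) hL hf hmaps

theorem le_of_ae_hasDerivAt_nonpos {f : ℝ → ℝ} {p q : ℝ} (hpq : p ≤ q)
    (hf : AbsolutelyContinuousOnInterval f p q)
    (hf' : ∀ᵐ t, t ∈ Icc p q → ∃ f' ≤ 0, HasDerivAt f f' t) : f q ≤ f p := by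
  have hint : ∫ t in p..q, deriv f t ≤ 0 := by
    rw [intervalIntegral.integral_of_le hpq]
    refine integral_nonpos_of_ae ((ae_restrict_iff' measurableSet_Ioc).2 ?_)
    filter_upwards [hf'] with t ht hmem
    obtain ⟨f', hle, hder⟩ := ht (Ioc_subset_Icc_self hmem)
    exact hder.deriv.trans_le hle
  rw [hf.integral_deriv_eq_sub] at hint
  exact sub_nonpos.1 hint

theorem exists_last_zero {f : ℝ → ℝ} {p q : ℝ} (hpq : p ≤ q) (hf : ContinuousOn f (Icc p q))
    (hp : f p ≤ 0) (hq : 0 < f q) : ∃ ξ ∈ Icc p q, f ξ = 0 ∧ ∀ s ∈ Icc ξ q, 0 ≤ f s := by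
  have hcompact : IsCompact (Icc p q ∩ f ⁻¹' {0}) := isCompact_Icc.of_isClosed_subset
    (hf.preimage_isClosed_of_isClosed isClosed_Icc isClosed_singleton) inter_subset_left
  have hzero : ∀ r ∈ Icc p q, f r ≤ 0 → ∃ s ∈ Icc r q, f s = 0 := fun r hr hfr =>
    intermediate_value_Icc hr.2 (hf.mono (Icc_subset_Icc hr.1 le_rfl)) ⟨hfr, hq.le⟩
  obtain ⟨η, hη, hη0⟩ := hzero p ⟨le_rfl, hpq⟩ hp
  obtain ⟨ξ, ⟨hξ, hξ0⟩, hlast⟩ := hcompact.exists_isGreatest ⟨η, hη, hη0⟩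
  refine ⟨ξ, hξ, hξ0, fun s hs => ?_⟩
  by_contra! hneg
  obtain ⟨r, hr, hr0⟩ := hzero s ⟨hξ.1.trans hs.1, hs.2⟩ hneg.le
  have hrξ : r ≤ ξ := hlast ⟨⟨hξ.1.trans (hs.1.trans hr.1), hr.2⟩, hr0⟩
  rw [le_antisymm (hr.1.trans hrξ) hs.1, hξ0] at hneg
  exact hneg.false

/-- A clock: an increasing, locally absolutely continuous function `B`, together with its rate `c`,
the almost everywhere derivative of `B`. Delays and decay are measured in the time `B t` instead of
`t`, in which the equation has the constant coefficient `1` in front of the undelayed term. -/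
structure IsClock (B c : ℝ → ℝ) : Prop where
  strictMono : StrictMono B
  absolutelyContinuousOnInterval : ∀ p q, AbsolutelyContinuousOnInterval B p q
  ae_hasDerivAt : ∀ᵐ t, HasDerivAt B (c t) t

namespace IsClock

variable {B c G k : ℝ → ℝ} {p q : ℝ}

theorem continuous (hB : IsClock B c) : Continuous B :=
  continuous_iff_continuousAt.2 fun t =>
    (hB.absolutelyContinuousOnInterval (t - 1) (t + 1)).continuousOn.continuousAt <| by
      rw [uIcc_of_le (by linarith)]
      exact Icc_mem_nhds (by linarith) (by linarith)

theorem const_mul (hB : IsClock B c) {r : ℝ} (hr : 0 < r) :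
    IsClock (fun t => r * B t) (fun t => r * c t) where
  strictMono := hB.strictMono.const_mul hr
  absolutelyContinuousOnInterval p q := (hB.absolutelyContinuousOnInterval p q).const_mul r
  ae_hasDerivAt := hB.ae_hasDerivAt.mono fun _ ht => ht.const_mul r

theorem exists_eq_add (hB : IsClock B c) (hpq : p ≤ q) {u : ℝ} (hu : 0 ≤ u)
    (hu' : u ≤ B q - B p) : ∃ r ∈ Icc p q, B r = B p + u :=
  intermediate_value_Icc hpq hB.continuous.continuousOn ⟨by linarith, by linarith⟩

theorem sub_le_mul_sub (hB : IsClock B c) (hG : IsClock G k) (hpq : p ≤ q) {μ : ℝ}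
    (hk : ∀ᵐ t, t ∈ Icc p q → k t ≤ μ * c t) : G q - G p ≤ μ * (B q - B p) := by
  have hle : G q - μ * B q ≤ G p - μ * B p := by
    refine le_of_ae_hasDerivAt_nonpos (f := fun t => G t - μ * B t) hpq
      ((hG.absolutelyContinuousOnInterval p q).fun_sub
        ((hB.absolutelyContinuousOnInterval p q).const_mul μ)) ?_
    filter_upwards [hk, hB.ae_hasDerivAt, hG.ae_hasDerivAt] with t hkt hBt hGt hmem
    exact ⟨_, sub_nonpos.2 (hkt hmem), hGt.sub (hBt.const_mul μ)⟩
  linarith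

theorem exp_mul_sub_exp_mul_le (hB : IsClock B c) {z : ℝ → ℝ} {C D : ℝ} (hpq : p ≤ q)
    (hz : AbsolutelyContinuousOnInterval z p q)
    (hz' : ∀ᵐ t, t ∈ Icc p q → ∃ z', HasDerivAt z z' t ∧
      z' + c t * z t ≤ c t * (C + D * Real.exp (-B t))) :
    Real.exp (B q) * z q - Real.exp (B p) * z p ≤
      C * (Real.exp (B q) - Real.exp (B p)) + D * (B q - B p) := by
  have hBac := hB.absolutelyContinuousOnInterval p q
  have hexp := absolutelyContinuousOnInterval_exp_comp hBac
  have hle := le_of_ae_hasDerivAt_nonpos hpq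
    (((hexp.fun_mul hz).fun_sub (hexp.const_mul C)).fun_sub (hBac.const_mul D)) (by
      filter_upwards [hz', hB.ae_hasDerivAt] with t ht hBt hmem
      obtain ⟨z', hder, hle⟩ := ht hmem
      refine ⟨_, ?_, ((hBt.exp.mul hder).sub (hBt.exp.const_mul C)).sub (hBt.const_mul D)⟩
      have hinv : Real.exp (B t) * Real.exp (-B t) = 1 := by rw [← Real.exp_add]; simp
      linear_combination Real.exp (B t) * hle + c t * D * hinv)
  linarith

end IsClock

theorem intervalIntegrable_of_locallyIntegrable {f : ℝ → ℝ} (hf : LocallyIntegrable f) (p q : ℝ) :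
    IntervalIntegrable f volume p q :=
  (hf.integrableOn_isCompact isCompact_uIcc).intervalIntegrable

theorem rate_mul_sub_le_integral_sub {c : ℝ → ℝ} {c₀ s t : ℝ} (hc : LocallyIntegrable c)
    (hc₀ : ∀ᵐ t, c₀ ≤ c t) (hst : s ≤ t) :
    c₀ * (t - s) ≤ (∫ r in (0 : ℝ)..t, c r) - ∫ r in (0 : ℝ)..s, c r := by
  have hint := intervalIntegrable_of_locallyIntegrable hc
  rw [intervalIntegral.integral_interval_sub_left (hint _ _) (hint _ _)]
  have hmono : ∫ _ in s..t, c₀ ≤ ∫ r in s..t, c r :=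
    intervalIntegral.integral_mono_ae hst intervalIntegrable_const (hint _ _) hc₀
  simpa [mul_comm] using hmono

theorem isClock_integral {c : ℝ → ℝ} {c₀ : ℝ} (hc : LocallyIntegrable c) (h₀ : 0 < c₀)
    (hc₀ : ∀ᵐ t, c₀ ≤ c t) : IsClock (fun t => ∫ s in (0 : ℝ)..t, c s) c where
  strictMono s t hst := sub_pos.1 <| (mul_pos h₀ (sub_pos.2 hst)).trans_le
    (rate_mul_sub_le_integral_sub hc hc₀ hst.le)
  absolutelyContinuousOnInterval p q := by
    have hint := intervalIntegrable_of_locallyIntegrable hc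
    have hac := (hint p q).absolutelyContinuousOnInterval_intervalIntegral left_mem_uIcc
    have hsplit : (fun t => ∫ s in (0 : ℝ)..t, c s) =
        fun t => (∫ s in (0 : ℝ)..p, c s) + ∫ s in p..t, c s := funext fun t =>
      (intervalIntegral.integral_add_adjacent_intervals (hint _ _) (hint _ _)).symm
    rw [hsplit]
    exact contDiffOn_const.absolutelyContinuousOnInterval.fun_add hac
  ae_hasDerivAt := (LocallyIntegrable.ae_hasDerivAt_integral hc).mono fun _ ht => ht 0

/-- The past of the time `t` that is at most `H` units of the clock `B` old. -/
def clockMemory (B : ℝ → ℝ) (H t : ℝ) : Set ℝ :=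
  {s | s ≤ t ∧ B t - B s ≤ H}

/-- The criterion of the theorem for the bound `β` of the ratio `∑ b_l / a` and the bound `H` of the
delays, multiplied by `β` so that `β = 0` satisfies it without a convention. -/
def YorkeCondition (β H : ℝ) : Prop :=
  0 ≤ β ∧ β * Real.log ((β ^ 2 + β) / (β ^ 2 + 1)) < Real.exp (-H)

/-- The clock time `u` with `β (exp (H - u) - 1) = 1`. A function with last zero `ξ` and maximum `S`
is estimated by `S` up to the clock time `u` after `ξ`, and by what its delayed argument can attain
before `ξ` from then on. -/
noncomputable def switchTime (β H : ℝ) : ℝ :=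
  H - Real.log (1 + 1 / β)

theorem one_add_mul_exp_switchTime {β H : ℝ} (hβ : 0 < β) :
    (1 + β) * Real.exp (switchTime β H) = β * Real.exp H := by
  rw [switchTime, Real.exp_sub, Real.exp_log (by positivity)]
  field_simp
  ring

theorem switchTime_nonneg {β H : ℝ} (hβ : 0 < β) (hH : Real.exp H ≤ β * (Real.exp H - 1)) :
    0 ≤ switchTime β H := by
  refine sub_nonneg.2 ((Real.log_le_iff_le_exp (by positivity)).2 ?_)
  have hE := Real.exp_pos H
  have hinv : 1 / β ≤ (Real.exp H - 1) / Real.exp H := by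
    rw [div_le_div_iff₀ hβ hE]
    linarith
  have htangent : (Real.exp H - 1) / Real.exp H ≤ Real.exp H - 1 := by
    rw [div_le_iff₀ hE]
    nlinarith [sq_nonneg (Real.exp H - 1)]
  linarith

theorem exp_le_mul_exp_sub_one_of_le {β r s : ℝ} (hβ : 0 ≤ β)
    (hr : Real.exp r ≤ β * (Real.exp r - 1)) (hrs : r ≤ s) :
    Real.exp s ≤ β * (Real.exp s - 1) := by
  have hβ1 : 0 ≤ β - 1 := le_of_mul_le_mul_right (by linarith) (Real.exp_pos r)
  have hexp := mul_le_mul_of_nonneg_left (Real.exp_le_exp.2 hrs) hβ1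
  linarith

theorem mul_log_div_eq {β : ℝ} (hβ : 0 ≤ β) : β * Real.log ((β ^ 2 + β) / (β ^ 2 + 1)) =
    β * Real.log β + β * Real.log ((β + 1) / (β ^ 2 + 1)) := by
  rcases hβ.eq_or_lt with rfl | hpos
  · simp only [zero_mul, add_zero]
  · rw [← mul_add, ← Real.log_mul hpos.ne' (by positivity)]
    ring_nf

theorem continuousAt_mul_log_add_mul_log {β : ℝ} (hβ : 0 ≤ β) :
    ContinuousAt (fun r => r * Real.log r + r * Real.log ((r + 1) / (r ^ 2 + 1))) β :=
  Real.continuous_mul_log.continuousAt.add <| continuousAt_id.mul <|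
    ContinuousAt.log (ContinuousAt.div (by fun_prop) (by fun_prop) (by positivity))
      (by positivity)

namespace YorkeCondition

variable {β H R : ℝ}

theorem mul_exp_neg_lt (h : YorkeCondition β H) (hβ : 0 < β) :
    (β ^ 2 + β) * Real.exp (-(Real.exp (-H) / β)) < β ^ 2 + 1 := by
  have hlog := (lt_div_iff₀' hβ).2 h.2
  rw [Real.log_lt_iff_lt_exp (by positivity), div_lt_iff₀' (by positivity)] at hlog
  rwa [Real.exp_neg, ← div_eq_mul_inv, div_lt_iff₀ (Real.exp_pos _)]

theorem two_stage_lt (h : YorkeCondition β H) (hβ : 0 < β) (r : ℝ) :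
    β * (Real.exp (switchTime β H) - 1) + β ^ 2 * (Real.exp H * (r - switchTime β H) -
      Real.exp r + Real.exp (switchTime β H)) < Real.exp r := by
  set u := switchTime β H
  set k := Real.exp (-H) / β with hk
  have hu : (1 + β) * Real.exp u = β * Real.exp H := one_add_mul_exp_switchTime hβ
  have hkH : β ^ 2 * Real.exp H * k = β := by
    rw [hk, Real.exp_neg]
    field_simp
  have htangent : β ^ 2 * Real.exp H * (1 + (r - u - k)) ≤
      (β ^ 2 + β) * Real.exp (-k) * Real.exp r := by
    calc β ^ 2 * Real.exp H * (1 + (r - u - k))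
        ≤ β ^ 2 * Real.exp H * Real.exp (r - u - k) := by
          gcongr
          linarith [Real.add_one_le_exp (r - u - k)]
      _ = (β ^ 2 + β) * (Real.exp u * Real.exp (r - u - k)) := by
          linear_combination -β * Real.exp (r - u - k) * hu
      _ = (β ^ 2 + β) * Real.exp (-k) * Real.exp r := by
          rw [mul_assoc, ← Real.exp_add, ← Real.exp_add]
          ring_nf
  have hcond : (β ^ 2 + β) * Real.exp (-k) * Real.exp r < (β ^ 2 + 1) * Real.exp r :=
    mul_lt_mul_of_pos_right (h.mul_exp_neg_lt hβ) (Real.exp_pos r)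
  clear_value k
  linear_combination hcond + htangent + β * hu + hkH

theorem exists_two_stage_lt (h : YorkeCondition β H) (hR : 0 ≤ R) (hRH : R ≤ H) :
    ∃ u ∈ Icc 0 R, β * (Real.exp u - 1) +
      β ^ 2 * (Real.exp H * (R - u) - Real.exp R + Real.exp u) < Real.exp R := by
  by_cases hone : β * (Real.exp R - 1) < Real.exp R
  · exact ⟨R, ⟨hR, le_rfl⟩, by simpa using hone⟩
  rw [not_lt] at hone
  have hβ : 0 < β := h.1.lt_of_ne' fun h0 => by
    rw [h0, zero_mul] at hone
    exact (Real.exp_pos R).not_ge hone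
  refine ⟨switchTime β H, ⟨switchTime_nonneg hβ ?_, ?_⟩, h.two_stage_lt hβ R⟩
  · exact exp_le_mul_exp_sub_one_of_le h.1 hone hRH
  · by_contra! hlt
    have hle := exp_le_mul_exp_sub_one_of_le h.1 hone hlt.le
    have hgt := h.two_stage_lt hβ (switchTime β H)
    linarith

theorem exists_perturbation (h : YorkeCondition β H) : ∃ β' H' α γ : ℝ, β < β' ∧ H < H' ∧
    0 < α ∧ α < 1 ∧ β' * Real.exp (α * H') ≤ (1 - α) * γ ∧ YorkeCondition γ H' := by
  let γ : ℝ → ℝ := fun ε => (β + ε) * Real.exp (ε * (H + ε)) / (1 - ε)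
  have hγ : ContinuousAt γ 0 := ContinuousAt.div (by fun_prop) (by fun_prop) (by norm_num)
  have hγ0 : γ 0 = β := by simp [γ]
  have hβ := h.1
  have hcont := (continuousAt_mul_log_add_mul_log hβ).comp_of_eq hγ hγ0
  have hev := hcont.eventually_lt (g := fun ε => Real.exp (-(H + ε))) (by fun_prop)
    (by simpa [hγ0, ← mul_log_div_eq hβ] using h.2)
  obtain ⟨ε, hlt, hε0, hε1⟩ := ((hev.filter_mono nhdsWithin_le_nhds).and
    (Ioo_mem_nhdsGT (zero_lt_one' ℝ))).exists
  have hε1' := sub_pos.2 hε1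
  have hγε : 0 ≤ γ ε := by positivity
  refine ⟨β + ε, H + ε, ε, γ ε, by linarith, by linarith, hε0, hε1, ?_, hγε, ?_⟩
  · exact (mul_div_cancel₀ _ hε1'.ne').ge
  · rwa [mul_log_div_eq hγε]

end YorkeCondition

/-- A subsolution of `x' + c x = g sup_E x⁻` on `[t₀, ∞)`, where `x⁻` is the negative part of `x`
and `E t` is the set of the times on which the delayed term at the time `t` depends. The supremum is
replaced by its upper bounds `C`, so that no boundedness of `x` is built in. -/
structure IsYorkeSubsolution (c g : ℝ → ℝ) (E : ℝ → Set ℝ) (t₀ : ℝ) (x : ℝ → ℝ) : Prop where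
  absolutelyContinuousOnInterval : ∀ T, t₀ ≤ T → AbsolutelyContinuousOnInterval x t₀ T
  ae_deriv_le : ∀ᵐ t, t₀ ≤ t → ∃ x', HasDerivAt x x' t ∧
    ∀ C, 0 ≤ C → (∀ s ∈ E t, -x s ≤ C) → x' + c t * x t ≤ g t * C

namespace IsYorkeSubsolution

variable {c g x : ℝ → ℝ} {E : ℝ → Set ℝ} {t₀ p q : ℝ}

theorem absolutelyContinuousOnInterval_of_le (hx : IsYorkeSubsolution c g E t₀ x) (hp : t₀ ≤ p)
    (hpq : p ≤ q) : AbsolutelyContinuousOnInterval x p q := by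
  refine (hx.absolutelyContinuousOnInterval q (hp.trans hpq)).mono ?_
  rw [uIcc_of_le hpq, uIcc_of_le (hp.trans hpq)]
  exact Icc_subset_Icc_left hp

theorem continuousOn (hx : IsYorkeSubsolution c g E t₀ x) (hp : t₀ ≤ p) (hpq : p ≤ q) :
    ContinuousOn x (Icc p q) := by
  simpa only [uIcc_of_le hpq] using (hx.absolutelyContinuousOnInterval_of_le hp hpq).continuousOn

end IsYorkeSubsolution

section ClockMemory

variable {B c z : ℝ → ℝ} {β H S t t₁ p q ξ : ℝ}

namespace IsYorkeSubsolution

theorem exp_mul_sub_exp_mul_le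
    (hz : IsYorkeSubsolution c (fun t => β * c t) (clockMemory B H) t₁ z) (hB : IsClock B c)
    (hp : t₁ ≤ p) (hpq : p ≤ q) {F : ℝ → ℝ} {C D : ℝ} (hF₀ : ∀ r ∈ Icc p q, 0 ≤ F r)
    (hF : ∀ r ∈ Icc p q, ∀ s ∈ clockMemory B H r, -z s ≤ F r)
    (hFB : ∀ r, β * F r = C + D * Real.exp (-B r)) :
    Real.exp (B q) * z q - Real.exp (B p) * z p ≤
      C * (Real.exp (B q) - Real.exp (B p)) + D * (B q - B p) := by
  refine hB.exp_mul_sub_exp_mul_le hpq (hz.absolutelyContinuousOnInterval_of_le hp hpq) ?_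
  filter_upwards [hz.ae_deriv_le] with r hr hmem
  obtain ⟨z', hder, hle⟩ := hr (hp.trans hmem.1)
  refine ⟨z', hder, (hle (F r) (hF₀ r hmem) (hF r hmem)).trans_eq ?_⟩
  rw [← hFB]
  ring

theorem clock_sub_le_of_nonneg
    (hz : IsYorkeSubsolution c (fun t => β * c t) (clockMemory B H) t₁ z) (hB : IsClock B c)
    (hH : 0 ≤ H) (hξ : t₁ ≤ ξ) (hξt : ξ ≤ t) (hnonneg : ∀ s ∈ Icc ξ t, 0 ≤ z s) (hpos : 0 < z t)
    (hmax : ∀ s ≤ t, z s ≤ z t) : B t - B ξ ≤ H := by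
  by_contra! hlt
  obtain ⟨τ, hτ, hBτ⟩ := hB.exists_eq_add hξt hH hlt.le
  have hdecay := hz.exp_mul_sub_exp_mul_le (F := fun _ => 0) (C := 0) (D := 0) hB
    (hξ.trans hτ.1) hτ.2 (fun _ _ => le_rfl)
    (fun r hr s hs => by
      have hBr := hB.strictMono.monotone hr.1
      have hξs : ξ ≤ s := hB.strictMono.le_iff_le.1 (by linarith [hs.2])
      exact neg_nonpos.2 (hnonneg s ⟨hξs, hs.1.trans hr.2⟩))
    (fun _ => by simp)
  have hexp : Real.exp (B τ) < Real.exp (B t) := Real.exp_lt_exp.2 (by linarith)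
  have hτmax := mul_le_mul_of_nonneg_left (hmax τ hτ.2) (Real.exp_pos (B τ)).le
  have hgap := mul_lt_mul_of_pos_right hexp hpos
  linarith

theorem exp_mul_sub_exp_mul_le_of_neg_le
    (hz : IsYorkeSubsolution c (fun t => β * c t) (clockMemory B H) t₁ z) (hB : IsClock B c)
    (hp : t₁ ≤ p) (hpq : p ≤ q) (hS₀ : 0 ≤ S) (hS : ∀ s ≤ q, -z s ≤ S) :
    Real.exp (B q) * z q - Real.exp (B p) * z p ≤
      β * S * (Real.exp (B q) - Real.exp (B p)) := by
  simpa using hz.exp_mul_sub_exp_mul_le (F := fun _ => S) (C := β * S) (D := 0) hB hp hpq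
    (fun _ _ => hS₀) (fun r hr s hs => hS s (hs.1.trans hr.2)) (fun _ => by simp)

theorem neg_le_of_eq_zero
    (hz : IsYorkeSubsolution c (fun t => β * c t) (clockMemory B H) t₁ z) (hB : IsClock B c)
    (hS₀ : 0 ≤ S) (hS : ∀ s ≤ ξ, -z s ≤ S) (hξ : z ξ = 0) (hp : t₁ ≤ p) (hpξ : p ≤ ξ) :
    -z p ≤ β * S * (Real.exp (B ξ - B p) - 1) := by
  have hle := hz.exp_mul_sub_exp_mul_le_of_neg_le hB hp hpξ hS₀ hS
  rw [hξ, mul_zero, zero_sub, ← mul_neg] at hle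
  refine le_of_mul_le_mul_left (hle.trans_eq ?_) (Real.exp_pos (B p))
  rw [Real.exp_sub]
  field_simp

theorem exp_mul_sub_exp_mul_le_of_last_zero
    (hz : IsYorkeSubsolution c (fun t => β * c t) (clockMemory B H) t₁ z) (hB : IsClock B c)
    (hβ : 0 ≤ β) (hS₀ : 0 ≤ S) (hS : ∀ s ≤ t, -z s ≤ S) (hξ : z ξ = 0)
    (hnonneg : ∀ s ∈ Icc ξ t, 0 ≤ z s) (hstart : B t₁ + H ≤ B ξ) (hlength : B t - B ξ ≤ H)
    (hp : p ∈ Icc ξ t) :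
    Real.exp (B t) * z t - Real.exp (B p) * z p ≤ β ^ 2 * S *
      (Real.exp (H + B ξ) * (B t - B p) - (Real.exp (B t) - Real.exp (B p))) := by
  have hmono := hB.strictMono.monotone
  have hle_iff := fun {r s : ℝ} => hB.strictMono.le_iff_le (a := r) (b := s)
  have hF₀ : ∀ r ∈ Icc p t, 0 ≤ β * S * (Real.exp (H + B ξ - B r) - 1) := fun r hr =>
    mul_nonneg (mul_nonneg hβ hS₀) <| sub_nonneg.2 <| Real.one_le_exp <| by
      linarith [hmono hr.2]
  have ht₁ : t₁ ≤ ξ := hle_iff.1 (by linarith [hmono hp.1, hmono hp.2])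
  have hrefined := hz.exp_mul_sub_exp_mul_le
    (F := fun r => β * S * (Real.exp (H + B ξ - B r) - 1)) (C := -(β ^ 2 * S))
    (D := β ^ 2 * S * Real.exp (H + B ξ)) hB (ht₁.trans hp.1) hp.2 hF₀
    (fun r hr s hs => by
      rcases le_total ξ s with hξs | hsξ
      · exact (neg_nonpos.2 (hnonneg s ⟨hξs, hs.1.trans hr.2⟩)).trans (hF₀ r hr)
      · have hBr := hmono (hp.1.trans hr.1)
        have hsB := hs.2
        have ht₁s : t₁ ≤ s := hle_iff.1 (by linarith)
        have hexp : Real.exp (B ξ - B s) ≤ Real.exp (H + B ξ - B r) :=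
          Real.exp_le_exp.2 (by linarith)
        refine (hz.neg_le_of_eq_zero hB hS₀ (fun s' hs' => hS s' (hs'.trans (hp.1.trans hp.2)))
          hξ ht₁s hsξ).trans ?_
        gcongr)
    (fun r => by rw [sub_eq_add_neg (H + B ξ), Real.exp_add (H + B ξ)]; ring)
  linarith

theorem exp_le_two_stage
    (hz : IsYorkeSubsolution c (fun t => β * c t) (clockMemory B H) t₁ z) (hB : IsClock B c)
    (hβ : 0 ≤ β) (hpos : 0 < z t) (hmax : ∀ s ≤ t, -z s ≤ z t) (hξ : z ξ = 0) (hξt : ξ ≤ t)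
    (hnonneg : ∀ s ∈ Icc ξ t, 0 ≤ z s) (hstart : B t₁ + H ≤ B ξ) (hlength : B t - B ξ ≤ H)
    {u : ℝ} (hu : u ∈ Icc 0 (B t - B ξ)) :
    Real.exp (B t - B ξ) ≤ β * (Real.exp u - 1) +
      β ^ 2 * (Real.exp H * (B t - B ξ - u) - Real.exp (B t - B ξ) + Real.exp u) := by
  obtain ⟨p, hp, hBp⟩ := hB.exists_eq_add hξt hu.1 hu.2
  have ht₁ : t₁ ≤ ξ := hB.strictMono.le_iff_le.1 (by linarith [hu.1, hu.2])
  have hcrude := hz.exp_mul_sub_exp_mul_le_of_neg_le hB ht₁ hp.1 hpos.le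
    fun s hs => hmax s (hs.trans hp.2)
  have hrefined := hz.exp_mul_sub_exp_mul_le_of_last_zero hB hβ hpos.le hmax hξ hnonneg hstart
    hlength hp
  have hEp : Real.exp (B p) = Real.exp u * Real.exp (B ξ) := by rw [hBp, add_comm, Real.exp_add]
  have hEt : Real.exp (B t) = Real.exp (B t - B ξ) * Real.exp (B ξ) := by
    rw [← Real.exp_add, sub_add_cancel]
  rw [hEp, hξ] at hcrude
  rw [hEp, hEt, Real.exp_add, hBp] at hrefined
  refine le_of_mul_le_mul_right ?_ (mul_pos (Real.exp_pos (B ξ)) hpos)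
  linarith

theorem not_forall_abs_le (hβ : YorkeCondition β H) (hH : 0 ≤ H)
    (hz : IsYorkeSubsolution c (fun t => β * c t) (clockMemory B H) t₁ z) (hB : IsClock B c)
    (ht : B t₁ + 2 * H < B t) (hpos : 0 < z t) : ¬ ∀ s ≤ t, |z s| ≤ z t := by
  intro hmax
  have hle : ∀ s ≤ t, z s ≤ z t := fun s hs => (le_abs_self _).trans (hmax s hs)
  have hneg : ∀ s ≤ t, -z s ≤ z t := fun s hs => (neg_le_abs _).trans (hmax s hs)
  have ht₁ : t₁ ≤ t := hB.strictMono.le_iff_le.1 (by linarith)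
  obtain ⟨r, hr, hzr⟩ : ∃ r ∈ Icc t₁ t, z r ≤ 0 := by
    by_contra! hall
    have hlength := hz.clock_sub_le_of_nonneg hB hH le_rfl ht₁ (fun s hs => (hall s hs).le)
      hpos hle
    linarith
  obtain ⟨ξ, hξ, hξ₀, hnonneg⟩ :=
    exists_last_zero hr.2 (hz.continuousOn hr.1 hr.2) hzr hpos
  have hlength := hz.clock_sub_le_of_nonneg hB hH (hr.1.trans hξ.1) hξ.2 hnonneg hpos hle
  obtain ⟨u, hu, hlt⟩ := hβ.exists_two_stage_lt
    (sub_nonneg.2 (hB.strictMono.monotone hξ.2)) hlength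
  exact hlt.not_ge
    (hz.exp_le_two_stage hB hβ.1 hpos hneg hξ₀ hξ.2 hnonneg (by linarith) hlength hu)

theorem abs_le_of_abs_le (hβ : YorkeCondition β H) (hH : 0 ≤ H)
    (hz : IsYorkeSubsolution c (fun t => β * c t) (clockMemory B H) t₁ z)
    (hz' : IsYorkeSubsolution c (fun t => β * c t) (clockMemory B H) t₁ (-z)) (hB : IsClock B c)
    {t₂ N : ℝ} (ht₂ : B t₁ + 2 * H ≤ B t₂) (hN : ∀ s ≤ t₂, |z s| ≤ N) (t : ℝ) : |z t| ≤ N := by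
  by_contra! hlt
  have h₂t : t₂ < t := by
    by_contra! hle
    exact hlt.not_ge (hN t hle)
  have h₁₂ : t₁ ≤ t₂ := hB.strictMono.le_iff_le.1 (by linarith)
  obtain ⟨τ, hτ, hτmax⟩ := isCompact_Icc.exists_isMaxOn (nonempty_Icc.2 h₂t.le)
    (hz.continuousOn h₁₂ h₂t.le).abs
  have hτN : N < |z τ| := hlt.trans_le (hτmax ⟨h₂t.le, le_rfl⟩)
  have h₂τ : t₂ < τ := hτ.1.lt_of_ne fun heq => hτN.not_ge (heq ▸ hN t₂ le_rfl)
  have hmax : ∀ s ≤ τ, |z s| ≤ |z τ| := fun s hs => by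
    rcases le_total s t₂ with hs₂ | hs₂
    · exact (hN s hs₂).trans hτN.le
    · exact hτmax ⟨hs₂, hs.trans hτ.2⟩
  have hBτ : B t₁ + 2 * H < B τ := ht₂.trans_lt (hB.strictMono h₂τ)
  have hpos : 0 < |z τ| := ((abs_nonneg _).trans (hN t₂ le_rfl)).trans_lt hτN
  rcases abs_choice (z τ) with habs | habs <;> rw [habs] at hpos hmax
  · exact not_forall_abs_le hβ hH hz hB hBτ hpos hmax
  · exact not_forall_abs_le hβ hH hz' hB hBτ hpos (by simpa only [Pi.neg_apply, abs_neg] using hmax)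

end IsYorkeSubsolution

end ClockMemory

namespace IsYorkeSubsolution

variable {A G c g x : ℝ → ℝ} {E : ℝ → Set ℝ} {t₀ t₁ : ℝ}

theorem sub_mul_exp_le (hx : IsYorkeSubsolution c g E t₀ x)
    (hG : IsClock G (fun t => c t + g t)) (hc : ∀ᵐ t, t₀ ≤ t → 0 ≤ c t)
    (hE : ∀ t, t₀ ≤ t → E t ⊆ Iic t) {S τ : ℝ} (hS : 0 ≤ S) (hτ : t₀ ≤ τ)
    (hle : ∀ r ∈ Icc t₀ τ, ∀ s ≤ r, |x s| ≤ S * Real.exp (G r - G t₀)) :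
    x τ - S * Real.exp (G τ - G t₀) ≤ x t₀ - S := by
  have hGac := hG.absolutelyContinuousOnInterval t₀ τ
  have hconst : AbsolutelyContinuousOnInterval (fun _ => G t₀) t₀ τ :=
    contDiffOn_const.absolutelyContinuousOnInterval
  have hdecr := le_of_ae_hasDerivAt_nonpos hτ ((hx.absolutelyContinuousOnInterval τ hτ).fun_sub
    ((absolutelyContinuousOnInterval_exp_comp (hGac.fun_sub hconst)).const_mul S)) (by
      filter_upwards [hx.ae_deriv_le, hG.ae_hasDerivAt, hc] with r hr hGr hcr hmem
      obtain ⟨x', hder, hx'⟩ := hr hmem.1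
      refine ⟨_, ?_, hder.sub ((hGr.sub_const (G t₀)).exp.const_mul S)⟩
      have hdelayed := hx' (S * Real.exp (G r - G t₀)) (by positivity)
        fun s hs => (neg_le_abs _).trans (hle r hmem s (hE r hmem.1 hs))
      have hundelayed := mul_le_mul_of_nonneg_left
        ((neg_le_abs _).trans (hle r hmem r le_rfl)) (hcr hmem.1)
      linarith)
  simpa using hdecr

theorem abs_le_mul_exp (hx : IsYorkeSubsolution c g E t₀ x)
    (hx' : IsYorkeSubsolution c g E t₀ (-x)) (hG : IsClock G (fun t => c t + g t))
    (hc : ∀ᵐ t, t₀ ≤ t → 0 ≤ c t) (hE : ∀ t, t₀ ≤ t → E t ⊆ Iic t) {N t : ℝ}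
    (hN : ∀ s ≤ t₀, |x s| ≤ N) (ht : t₀ ≤ t) :
    |x t| ≤ N * Real.exp (G t - G t₀) := by
  have hGmono := hG.strictMono.monotone
  obtain ⟨τ, hτ, hτmax⟩ := isCompact_Icc.exists_isMaxOn (nonempty_Icc.2 ht)
    ((hx.continuousOn le_rfl ht).abs.div (hG.continuous.sub continuous_const).rexp.continuousOn
      fun s _ => (Real.exp_pos (G s - G t₀)).ne')
  set S := |x τ| / Real.exp (G τ - G t₀)
  have hS₀ : 0 ≤ S := by positivity
  have hbound : ∀ s ∈ Icc t₀ t, |x s| ≤ S * Real.exp (G s - G t₀) := fun s hs =>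
    (div_le_iff₀ (Real.exp_pos _)).1 (hτmax hs)
  suffices hSN : S ≤ N from (hbound t ⟨ht, le_rfl⟩).trans (by gcongr)
  by_contra! hlt
  have hle : ∀ r ∈ Icc t₀ τ, ∀ s ≤ r, |x s| ≤ S * Real.exp (G r - G t₀) := by
    intro r hr s hs
    rcases le_total s t₀ with hs₀ | hs₀
    · exact ((hN s hs₀).trans hlt.le).trans (le_mul_of_one_le_right (by positivity)
        (Real.one_le_exp (sub_nonneg.2 (hGmono hr.1))))
    · refine (hbound s ⟨hs₀, hs.trans (hr.2.trans hτ.2)⟩).trans ?_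
      have hGs := hGmono hs
      gcongr
  have hτS : S * Real.exp (G τ - G t₀) = |x τ| := div_mul_cancel₀ _ (Real.exp_pos _).ne'
  have hN₀ := abs_le.1 (hN t₀ le_rfl)
  have hupper := hx.sub_mul_exp_le hG hc hE hS₀ hτ.1 hle
  have hlower := hx'.sub_mul_exp_le hG hc hE hS₀ hτ.1
    (by simpa only [Pi.neg_apply, abs_neg] using hle)
  rw [hτS, Pi.neg_apply, Pi.neg_apply] at hlower
  rcases abs_choice (x τ) with habs | habs <;> linarith [hN₀.1, hN₀.2]

theorem mono_start (hx : IsYorkeSubsolution c g E t₀ x) (h : t₀ ≤ t₁) :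
    IsYorkeSubsolution c g E t₁ x where
  absolutelyContinuousOnInterval _ hT := hx.absolutelyContinuousOnInterval_of_le h hT
  ae_deriv_le := hx.ae_deriv_le.mono fun _ ht ht₁ => ht (h.trans ht₁)

theorem exp_mul {α β γ H : ℝ} (hx : IsYorkeSubsolution c g E t₀ x) (hA : IsClock A c)
    (hc : ∀ᵐ t, t₀ ≤ t → 0 ≤ c t) (hg : ∀ᵐ t, t₀ ≤ t → g t ≤ β * c t)
    (hE : ∀ t, t₀ ≤ t → E t ⊆ clockMemory A H t) (hα : 0 ≤ α)
    (hγ : β * Real.exp (α * H) ≤ (1 - α) * γ) :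
    IsYorkeSubsolution (fun t => (1 - α) * c t) (fun t => γ * ((1 - α) * c t))
      (clockMemory (fun t => (1 - α) * A t) H) t₀ ((fun t => Real.exp (α * A t)) * x) where
  absolutelyContinuousOnInterval T hT := (absolutelyContinuousOnInterval_exp_comp
    ((hA.absolutelyContinuousOnInterval t₀ T).const_mul α)).fun_mul
      (hx.absolutelyContinuousOnInterval T hT)
  ae_deriv_le := by
    filter_upwards [hx.ae_deriv_le, hA.ae_hasDerivAt, hc, hg] with t ht hAt hct hgt h₀
    obtain ⟨x', hder, hx'⟩ := ht h₀
    refine ⟨_, (hAt.const_mul α).exp.mul hder, fun C hC hz => ?_⟩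
    have hpast : ∀ s ∈ E t, -x s ≤ C * Real.exp (α * H - α * A t) := fun s hs => by
      have hmem := hE t h₀ hs
      have hage : 0 ≤ α * (A t - A s) :=
        mul_nonneg hα (sub_nonneg.2 (hA.strictMono.monotone hmem.1))
      have hzs : -(Real.exp (α * A s) * x s) ≤ C := hz s ⟨hmem.1, by linarith [hmem.2]⟩
      calc -x s = -(Real.exp (α * A s) * x s) * Real.exp (-(α * A s)) := by
            rw [Real.exp_neg]
            field_simp
        _ ≤ C * Real.exp (α * H - α * A t) := by
            gcongr
            linarith [mul_le_mul_of_nonneg_left hmem.2 hα]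
    have hweight := mul_le_mul_of_nonneg_left (hx' _ (by positivity) hpast)
      (Real.exp_pos (α * A t)).le
    have hcancel : Real.exp (α * A t) * Real.exp (α * H - α * A t) = Real.exp (α * H) := by
      rw [← Real.exp_add, add_sub_cancel]
    have hratio := mul_le_mul_of_nonneg_right (hgt h₀)
      (by positivity : 0 ≤ C * Real.exp (α * H))
    have hroom := mul_le_mul_of_nonneg_right hγ (mul_nonneg (hct h₀) hC)
    simp only [Pi.mul_apply]
    linear_combination hweight + hratio + hroom + g t * C * hcancel

theorem abs_le_mul_exp_neg {α β γ H t₂ N : ℝ} (hx : IsYorkeSubsolution c g E t₀ x)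
    (hx' : IsYorkeSubsolution c g E t₀ (-x)) (hA : IsClock A c)
    (hc : ∀ᵐ t, t₀ ≤ t → 0 ≤ c t) (hg : ∀ᵐ t, t₀ ≤ t → g t ≤ β * c t)
    (hE : ∀ t, t₀ ≤ t → E t ⊆ clockMemory A H t) (hα : 0 ≤ α) (hα' : α < 1) (hH : 0 ≤ H)
    (hγ : β * Real.exp (α * H) ≤ (1 - α) * γ) (hY : YorkeCondition γ H)
    (ht₂ : A t₀ + 2 * H / (1 - α) ≤ A t₂) (hN : ∀ s ≤ t₂, |x s| ≤ N) (t : ℝ) :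
    |x t| ≤ N * Real.exp (α * (A t₂ - A t)) := by
  have hα₁ : 0 < 1 - α := sub_pos.2 hα'
  have hweighted : ∀ s ≤ t₂, |Real.exp (α * A s) * x s| ≤ Real.exp (α * A t₂) * N := by
    intro s hs
    rw [abs_mul, Real.abs_exp]
    have hAs := hA.strictMono.monotone hs
    have hNs := hN s hs
    gcongr
  have hz := abs_le_of_abs_le hY hH (hx.exp_mul hA hc hg hE hα hγ)
    (by simpa only [mul_neg] using hx'.exp_mul hA hc hg hE hα hγ) (hA.const_mul hα₁)
    (by rwa [← mul_div_cancel₀ (2 * H) hα₁.ne', ← mul_add, mul_le_mul_iff_right₀ hα₁]) hweighted t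
  rw [Pi.mul_apply, abs_mul, Real.abs_exp] at hz
  rw [mul_sub, Real.exp_sub, mul_div_assoc', le_div_iff₀ (Real.exp_pos _)]
  linarith

end IsYorkeSubsolution

theorem IsClock.sub_le_of_sub_max_le {A G c g : ℝ → ℝ} {β δ T t₀ s : ℝ} (hA : IsClock A c)
    (hG : IsClock G (fun t => c t + g t)) (hg : ∀ᵐ t, T ≤ t → g t ≤ β * c t) (hβ : 0 ≤ β)
    (hδ : 0 ≤ δ) (ht₀ : 0 ≤ t₀) (hs : A s ≤ A (max t₀ T) + δ) :
    G s - G t₀ ≤ G (max 0 T) - G 0 + (1 + β) * δ := by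
  have hGmono := hG.strictMono.monotone
  have hstart : G (max t₀ T) - G t₀ ≤ G (max 0 T) - G 0 := by
    rcases le_total t₀ T with h | h
    · rw [max_eq_right h, max_eq_right (ht₀.trans h)]
      linarith [hGmono ht₀]
    · rw [max_eq_left h, sub_self]
      exact sub_nonneg.2 (hGmono (le_max_left 0 T))
  have hrest : G s - G (max t₀ T) ≤ (1 + β) * δ := by
    rcases le_total s (max t₀ T) with h | h
    · exact (sub_nonpos.2 (hGmono h)).trans (by positivity)
    · refine (hA.sub_le_mul_sub hG h (μ := 1 + β) ?_).trans ?_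
      · filter_upwards [hg] with t ht hmem
        linarith [ht ((le_max_right _ _).trans hmem.1)]
      · gcongr
        linarith
  linarith

theorem IsClock.exists_ge_eq_add {A c : ℝ → ℝ} {a₀ u : ℝ} (hA : IsClock A c) (ha₀ : 0 < a₀)
    (hrate : ∀ s t, s ≤ t → a₀ * (t - s) ≤ A t - A s) (p : ℝ) (hu : 0 ≤ u) :
    ∃ r ≥ p, A r = A p + u := by
  have hp : p ≤ p + u / a₀ := le_add_of_nonneg_right (by positivity)
  have hlong : u ≤ A (p + u / a₀) - A p := by
    simpa only [add_sub_cancel_left, mul_div_cancel₀ _ ha₀.ne'] using hrate p (p + u / a₀) hp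
  obtain ⟨r, hr, hAr⟩ := hA.exists_eq_add hp hu hlong
  exact ⟨r, hr.1, hAr⟩

section Decay

variable {A G c g x : ℝ → ℝ} {E : ℝ → Set ℝ} {T a₀ α β γ δ H t₀ N s : ℝ}

theorem IsYorkeSubsolution.abs_le_mul_exp_of_clock_le (hx : IsYorkeSubsolution c g E t₀ x)
    (hx' : IsYorkeSubsolution c g E t₀ (-x)) (hA : IsClock A c)
    (hG : IsClock G (fun t => c t + g t)) (hc : ∀ᵐ t, 0 ≤ t → 0 ≤ c t)
    (hE : ∀ t, 0 ≤ t → E t ⊆ Iic t) (hgT : ∀ᵐ t, T ≤ t → g t ≤ β * c t) (hβ : 0 ≤ β)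
    (hδ : 0 ≤ δ) (ht₀ : 0 ≤ t₀) (hN : ∀ s ≤ t₀, |x s| ≤ N)
    (hs : A s ≤ A (max t₀ T) + δ) :
    |x s| ≤ N * Real.exp (G (max 0 T) - G 0 + (1 + β) * δ) := by
  have hN₀ : 0 ≤ N := (abs_nonneg _).trans (hN t₀ le_rfl)
  rcases le_total s t₀ with hs₀ | hs₀
  · refine (hN s hs₀).trans (le_mul_of_one_le_right hN₀ (Real.one_le_exp ?_))
    exact add_nonneg (sub_nonneg.2 (hG.strictMono.monotone (le_max_left 0 T))) (by positivity)
  · refine (hx.abs_le_mul_exp hx' hG (hc.mono fun _ h ht => h (ht₀.trans ht))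
      (fun t ht => hE t (ht₀.trans ht)) hN hs₀).trans ?_
    gcongr
    exact hA.sub_le_of_sub_max_le hG hgT hβ hδ ht₀ hs

theorem exists_abs_le_mul_exp_neg (hA : IsClock A c) (hG : IsClock G (fun t => c t + g t))
    (ha₀ : 0 < a₀) (hrate : ∀ s t, s ≤ t → a₀ * (t - s) ≤ A t - A s)
    (hc : ∀ᵐ t, 0 ≤ t → 0 ≤ c t) (hg : ∀ᵐ t, 0 ≤ t → 0 ≤ g t) (hE : ∀ t, 0 ≤ t → E t ⊆ Iic t)
    (hgT : ∀ᵐ t, T ≤ t → g t ≤ β * c t) (hET : ∀ t, T ≤ t → E t ⊆ clockMemory A H t)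
    (hβ : 0 ≤ β) (hH : 0 ≤ H) (hα : 0 < α) (hα' : α < 1)
    (hγ : β * Real.exp (α * H) ≤ (1 - α) * γ) (hY : YorkeCondition γ H) :
    ∃ M > 0, ∀ t₀, 0 ≤ t₀ → ∀ (x : ℝ → ℝ) (N : ℝ), IsYorkeSubsolution c g E t₀ x →
      IsYorkeSubsolution c g E t₀ (-x) → (∀ s ≤ t₀, |x s| ≤ N) →
      ∀ t, t₀ ≤ t → |x t| ≤ M * N * Real.exp (-(α * a₀) * (t - t₀)) := by
  have hδ : 0 ≤ 2 * H / (1 - α) := div_nonneg (by positivity) (sub_nonneg.2 hα'.le)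
  obtain ⟨D, hD⟩ : ∃ D, D = G (max 0 T) - G 0 + (1 + β) * (2 * H / (1 - α)) := ⟨_, rfl⟩
  refine ⟨Real.exp (2 * D), Real.exp_pos _, fun t₀ ht₀ x N hx hx' hN t ht => ?_⟩
  have hN₀ : 0 ≤ N := (abs_nonneg _).trans (hN t₀ le_rfl)
  have h₀₁ : t₀ ≤ max t₀ T := le_max_left _ _
  obtain ⟨t₂, ht₂, hAt₂⟩ := hA.exists_ge_eq_add ha₀ hrate (max t₀ T) hδ
  have hearly : ∀ s ≤ t₂, |x s| ≤ N * Real.exp D := fun s hs =>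
    hD ▸ hx.abs_le_mul_exp_of_clock_le hx' hA hG hc hE hgT hβ hδ ht₀ hN
      (hAt₂ ▸ hA.strictMono.monotone hs)
  have hlate := (hx.mono_start h₀₁).abs_le_mul_exp_neg (hx'.mono_start h₀₁) hA
    (hc.mono fun _ h ht => h (ht₀.trans (h₀₁.trans ht)))
    (hgT.mono fun _ h ht => h ((le_max_right _ _).trans ht))
    (fun t ht => hET t ((le_max_right _ _).trans ht)) hα.le hα' hH hγ hY hAt₂.ge hearly t
  have hclock : A t₂ - A t₀ ≤ D := by
    refine (hG.sub_le_mul_sub hA (h₀₁.trans ht₂) (μ := 1) ?_).trans ?_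
    · filter_upwards [hg] with s hs hmem
      linarith [hs (ht₀.trans hmem.1)]
    · rw [one_mul, hD]
      exact hA.sub_le_of_sub_max_le hG hgT hβ hδ ht₀ hAt₂.le
  have hexponent : D + α * (A t₂ - A t) ≤ 2 * D + -(α * a₀) * (t - t₀) := by
    have hdecay := mul_le_mul_of_nonneg_left (hrate t₀ t ht) hα.le
    have hloss := mul_le_mul_of_nonneg_left hclock hα.le
    have hαD : α * D ≤ D := mul_le_of_le_one_left
      ((sub_nonneg.2 (hA.strictMono.monotone (h₀₁.trans ht₂))).trans hclock) hα'.le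
    linarith
  calc |x t| ≤ N * Real.exp D * Real.exp (α * (A t₂ - A t)) := hlate
    _ = N * Real.exp (D + α * (A t₂ - A t)) := by rw [Real.exp_add, mul_assoc]
    _ ≤ N * Real.exp (2 * D + -(α * a₀) * (t - t₀)) := by gcongr
    _ = Real.exp (2 * D) * N * Real.exp (-(α * a₀) * (t - t₀)) := by rw [Real.exp_add]; ring

end Decay

theorem exists_isClock_of_locallyIntegrableOn {f : ℝ → ℝ} {c₀ : ℝ}
    (hf : LocallyIntegrableOn f (Ici 0)) (h₀ : 0 < c₀)
    (hf₀ : ∀ᵐ t ∂(volume.restrict (Ici 0)), c₀ ≤ f t) :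
    ∃ A c : ℝ → ℝ, IsClock A c ∧ EqOn c f (Ici 0) ∧
      (∀ s t, s ≤ t → c₀ * (t - s) ≤ A t - A s) ∧
      ∀ p q, 0 ≤ p → 0 ≤ q → ∫ s in p..q, f s = A q - A p := by
  set c := (Ici (0 : ℝ)).piecewise f fun _ => c₀
  have hEq : EqOn c f (Ici 0) := piecewise_eqOn _ _ _
  have hc : LocallyIntegrable c := by
    refine locallyIntegrable_iff.2 fun k hk => Integrable.piecewise measurableSet_Ici ?_ ?_
    · rw [IntegrableOn, Measure.restrict_restrict measurableSet_Ici]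
      exact hf.integrableOn_compact_subset inter_subset_left (hk.inter_left isClosed_Ici)
    · have : IsFiniteMeasure (volume.restrict k) := ⟨by simpa using hk.measure_lt_top⟩
      exact (integrable_const c₀).integrableOn
  have hc₀ : ∀ᵐ t, c₀ ≤ c t := by
    filter_upwards [ae_imp_of_ae_restrict hf₀] with t ht
    by_cases hmem : t ∈ Ici (0 : ℝ)
    · exact (ht hmem).trans_eq (hEq hmem).symm
    · exact (piecewise_eq_of_notMem (Ici 0) f (fun _ => c₀) hmem).ge
  refine ⟨_, c, isClock_integral hc h₀ hc₀, hEq,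
    fun _ _ => rate_mul_sub_le_integral_sub hc hc₀, fun p q hp hq => ?_⟩
  have hint := intervalIntegrable_of_locallyIntegrable hc
  rw [intervalIntegral.integral_interval_sub_left (hint _ _) (hint _ _)]
  exact intervalIntegral.integral_congr fun s hs =>
    (hEq (mem_Ici.2 ((le_min hp hq).trans hs.1))).symm

theorem exists_isClock_isClock_add {f g : ℝ → ℝ} {c₀ : ℝ} (hf : LocallyIntegrableOn f (Ici 0))
    (hg : LocallyIntegrableOn g (Ici 0)) (h₀ : 0 < c₀)
    (hf₀ : ∀ᵐ t ∂(volume.restrict (Ici 0)), c₀ ≤ f t)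
    (hg₀ : ∀ᵐ t ∂(volume.restrict (Ici 0)), 0 ≤ g t) :
    ∃ A G c d : ℝ → ℝ, IsClock A c ∧ IsClock G (fun t => c t + d t) ∧
      EqOn c f (Ici 0) ∧ EqOn d g (Ici 0) ∧ (∀ s t, s ≤ t → c₀ * (t - s) ≤ A t - A s) ∧
      ∀ p q, 0 ≤ p → 0 ≤ q → ∫ s in p..q, f s = A q - A p := by
  obtain ⟨A, c, hA, hcf, hrate, hint⟩ := exists_isClock_of_locallyIntegrableOn hf h₀ hf₀
  obtain ⟨G, k, hG, hk, -⟩ := exists_isClock_of_locallyIntegrableOn (hf.add hg) h₀ <| by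
    filter_upwards [hf₀, hg₀] with t hft hgt using le_add_of_le_of_nonneg hft hgt
  refine ⟨A, G, c, k - c, hA, ?_, hcf, fun t ht => ?_, hrate, hint⟩
  · simpa only [Pi.sub_apply, add_sub_cancel] using hG
  · rw [Pi.sub_apply, hk ht, hcf ht, Pi.add_apply, add_sub_cancel_left]

theorem iUnion_Icc_subset_clockMemory {ι : Type*} [Finite ι] {A c : ℝ → ℝ} {h : ι → ℝ → ℝ}
    {H t : ℝ} (hA : IsClock A c) (ht : A t - A (⨅ i, h i t) ≤ H) :
    ⋃ i, Icc (h i t) t ⊆ clockMemory A H t :=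
  iUnion_subset fun i _ hs => ⟨hs.2,
    (sub_le_sub_left (hA.strictMono.monotone ((ciInf_le (finite_range _).bddBelow i).trans hs.1))
      _).trans ht⟩

theorem neg_integral_kernel_mul_le {h : ℝ → ℝ} {K : ℝ → ℝ → ℝ} (hh : ∀ t, 0 ≤ t → h t ≤ t)
    (hK : ∀ᵐ p ∂(volume.restrict (kernelDomain h)), 0 ≤ K p.1 p.2)
    (hK' : ∀ᵐ t ∂(volume.restrict (Ici 0)), ∫ s in (h t)..t, K t s = 1) :
    ∀ᵐ t, 0 ≤ t → ∀ (y : ℝ → ℝ) (C : ℝ), 0 ≤ C → (∀ s ∈ Icc (h t) t, -y s ≤ C) →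
      -∫ s in (h t)..t, K t s * y s ≤ C := by
  have hpos : ∀ᵐ t, ∀ᵐ s, (t, s) ∈ kernelDomain h → 0 ≤ K t s :=
    Measure.ae_ae_of_ae_prod (ae_imp_of_ae_restrict hK)
  filter_upwards [hpos, ae_imp_of_ae_restrict hK'] with t hpos_t hone ht y C hC hy
  have hone := hone ht
  by_cases hKy : IntervalIntegrable (fun s => K t s * y s) volume (h t) t
  · have hint : IntervalIntegrable (K t) volume (h t) t :=
      not_imp_comm.1 intervalIntegral.integral_undef (hone ▸ one_ne_zero)
    have hmono : ∫ s in (h t)..t, -C * K t s ≤ ∫ s in (h t)..t, K t s * y s := by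
      refine intervalIntegral.integral_mono_ae_restrict (hh t ht) (hint.const_mul _) hKy ?_
      refine (ae_restrict_iff' measurableSet_Icc).2 ?_
      filter_upwards [hpos_t] with s hs hmem
      have hweighted := mul_le_mul_of_nonneg_left (hy s hmem) (hs ⟨ht, hmem.1, hmem.2⟩)
      linarith
    rw [intervalIntegral.integral_const_mul, hone] at hmono
    linarith
  · rwa [intervalIntegral.integral_undef hKy, neg_zero]

namespace IsSolution

variable {m : ℕ} {a : ℝ → ℝ} {b h : Fin m → ℝ → ℝ} {K : Fin m → ℝ → ℝ → ℝ} {t₀ : ℝ}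
  {φ x : ℝ → ℝ}

theorem neg (hx : IsSolution a b h K t₀ φ x) : IsSolution a b h K t₀ (-φ) (-x) := by
  refine ⟨fun T hT => (hx.1 T hT).fun_neg, ?_, fun t ht => congrArg Neg.neg (hx.2.2 t ht)⟩
  filter_upwards [hx.2.1] with t ⟨x', hder, heq⟩
  refine ⟨-x', hder.neg, ?_⟩
  simp only [Pi.neg_apply, mul_neg, intervalIntegral.integral_neg, Finset.sum_neg_distrib]
  linarith

theorem isYorkeSubsolution (hx : IsSolution a b h K t₀ φ x) (ht₀ : 0 ≤ t₀)
    (hb : ∀ l, ∀ᵐ t ∂(volume.restrict (Ici 0)), 0 ≤ b l t) (hh : ∀ l t, 0 ≤ t → h l t ≤ t)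
    (hK : ∀ l, ∀ᵐ p ∂(volume.restrict (kernelDomain (h l))), 0 ≤ K l p.1 p.2)
    (hK' : ∀ l, ∀ᵐ t ∂(volume.restrict (Ici 0)), ∫ s in (h l t)..t, K l t s = 1) :
    IsYorkeSubsolution a (fun t => ∑ l, b l t) (fun t => ⋃ l, Icc (h l t) t) t₀ x where
  absolutelyContinuousOnInterval := hx.1
  ae_deriv_le := by
    have haverage := ae_all_iff.2 fun l => neg_integral_kernel_mul_le (hh l) (hK l) (hK' l)
    have hpos := ae_all_iff.2 fun l => ae_imp_of_ae_restrict (hb l)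
    filter_upwards [ae_imp_of_ae_restrict hx.2.1, haverage, hpos] with t heq havg hbt ht
    obtain ⟨x', hder, hx'⟩ := heq ht
    refine ⟨x', hder, fun C hC hpast => ?_⟩
    calc x' + a t * x t = ∑ l, b l t * -∫ s in (h l t)..t, K l t s * x s := by
          simp only [mul_neg, Finset.sum_neg_distrib]
          linarith
      _ ≤ ∑ l, b l t * C := Finset.sum_le_sum fun l _ =>
          mul_le_mul_of_nonneg_left
            (havg l (ht₀.trans ht) x C hC fun s hs => hpast s (mem_iUnion.2 ⟨l, hs⟩))
            (hbt l (ht₀.trans ht))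
      _ = (∑ l, b l t) * C := (Finset.sum_mul _ _ _).symm

theorem abs_le_iSup (hx : IsSolution a b h K t₀ φ x) (hφ : IsInitialFunction t₀ φ) {s : ℝ}
    (hs : s ≤ t₀) : |x s| ≤ ⨆ r : Iic t₀, |φ r| := by
  obtain ⟨C, hC⟩ := hφ.2
  rw [hx.2.2 s hs]
  exact le_ciSup (f := fun r : Iic t₀ => |φ r|) ⟨C, forall_mem_range.2 fun r => hC r r.2⟩ ⟨s, hs⟩

end IsSolution

theorem IsYorkeSubsolution.congr {c c' g g' x : ℝ → ℝ} {E : ℝ → Set ℝ} {t₀ : ℝ}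
    (hx : IsYorkeSubsolution c g E t₀ x) (hc : EqOn c' c (Ici t₀)) (hg : EqOn g' g (Ici t₀)) :
    IsYorkeSubsolution c' g' E t₀ x where
  absolutelyContinuousOnInterval := hx.absolutelyContinuousOnInterval
  ae_deriv_le := hx.ae_deriv_le.mono fun t ht h₀ => by
    rw [hc h₀, hg h₀]
    exact ht h₀

theorem exponentiallyStable_of_forall_ge {m : ℕ} {a : ℝ → ℝ} {b h : Fin m → ℝ → ℝ}
    {K : Fin m → ℝ → ℝ → ℝ} {a₀ : ℝ} (hm : 0 < m) (ha₀ : 0 < a₀)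
    (ha : LocallyIntegrableOn a (Ici 0)) (haa₀ : ∀ᵐ t ∂(volume.restrict (Ici 0)), a₀ ≤ a t)
    (hb : ∀ l, LocallyIntegrableOn (b l) (Ici 0))
    (hb_nonneg : ∀ l, ∀ᵐ t ∂(volume.restrict (Ici 0)), 0 ≤ b l t)
    (hh : ∀ l t, 0 ≤ t → h l t ≤ t)
    (hK_nonneg : ∀ l, ∀ᵐ p ∂(volume.restrict (kernelDomain (h l))), 0 ≤ K l p.1 p.2)
    (hK_one : ∀ l, ∀ᵐ t ∂(volume.restrict (Ici 0)), ∫ s in (h l t)..t, K l t s = 1)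
    {T β H α γ : ℝ} (hT : 0 ≤ T) (hβ : 0 ≤ β)
    (hratio : ∀ᵐ t, T ≤ t → ∑ l, b l t ≤ β * a t)
    (hdelay : ∀ t, T ≤ t → 0 ≤ (⨅ l, h l t) ∧ delayIntegral a h t ≤ H)
    (hα : 0 < α) (hα' : α < 1) (hγ : β * Real.exp (α * H) ≤ (1 - α) * γ)
    (hY : YorkeCondition γ H) : ExponentiallyStable a b h K := by
  have hsum : ∀ᵐ t ∂(volume.restrict (Ici 0)), 0 ≤ ∑ l, b l t :=
    (ae_all_iff.2 hb_nonneg).mono fun t ht => Finset.sum_nonneg fun l _ => ht l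
  have hsum_int : LocallyIntegrableOn (fun t => ∑ l, b l t) (Ici 0) :=
    locallyIntegrableOn_of_locallyIntegrable_restrict <| locallyIntegrable_finsetSum _ fun l _ =>
      (locallyIntegrableOn_iff_locallyIntegrable_restrict isClosed_Ici).1 (hb l)
  obtain ⟨A, G, c, g, hA, hG, hca, hgb, hrate, hint⟩ :=
    exists_isClock_isClock_add ha hsum_int ha₀ haa₀ hsum
  have hmemory : ∀ t, T ≤ t → A t - A (⨅ l, h l t) ≤ H := fun t ht =>
    (hint _ _ (hdelay t ht).1 (hT.trans ht)).symm.trans_le (hdelay t ht).2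
  have hmin : (⨅ l, h l T) ≤ T :=
    (ciInf_le (finite_range _).bddBelow ⟨0, hm⟩).trans (hh ⟨0, hm⟩ T hT)
  have hH : 0 ≤ H :=
    (sub_nonneg.2 (hA.strictMono.monotone hmin)).trans (hmemory T le_rfl)
  have hc : ∀ᵐ t, 0 ≤ t → 0 ≤ c t := (ae_imp_of_ae_restrict haa₀).mono fun t hat ht =>
    ha₀.le.trans ((hat ht).trans_eq (hca ht).symm)
  have hg : ∀ᵐ t, 0 ≤ t → 0 ≤ g t := (ae_imp_of_ae_restrict hsum).mono fun t hbt ht =>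
    (hbt ht).trans_eq (hgb ht).symm
  have hgT : ∀ᵐ t, T ≤ t → g t ≤ β * c t := hratio.mono fun t hr ht => by
    rw [hgb (hT.trans ht), hca (hT.trans ht)]
    exact hr ht
  obtain ⟨M, hM, hstable⟩ := exists_abs_le_mul_exp_neg (E := fun t => ⋃ l, Icc (h l t) t) hA hG
    ha₀ hrate hc hg (fun t _ => iUnion_subset fun l => Icc_subset_Iic_self) hgT
    (fun t ht => iUnion_Icc_subset_clockMemory hA (hmemory t ht)) hβ hH hα hα' hγ hY
  refine ⟨M, hM, α * a₀, by positivity, fun t₀ ht₀ φ x hφ hx => ?_⟩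
  have hsub : ∀ {ψ y : ℝ → ℝ}, IsSolution a b h K t₀ ψ y →
      IsYorkeSubsolution c g (fun t => ⋃ l, Icc (h l t) t) t₀ y := fun hy =>
    (hy.isYorkeSubsolution ht₀ hb_nonneg hh hK_nonneg hK_one).congr
      (hca.mono (Ici_subset_Ici.2 ht₀)) (hgb.mono (Ici_subset_Ici.2 ht₀))
  exact hstable t₀ ht₀ x _ (hsub hx) (hsub hx.neg) fun s hs => hx.abs_le_iSup hφ hs

theorem yorkeCondition_max_zero {r H : ℝ}
    (h : r = 0 ∨ Real.log ((r ^ 2 + r) / (r ^ 2 + 1)) < 1 / r * Real.exp (-H)) :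
    YorkeCondition (max r 0) H := by
  refine ⟨le_max_right _ _, ?_⟩
  rcases le_or_gt r 0 with hr | hr
  · rw [max_eq_right hr, zero_mul]
    exact Real.exp_pos _
  · rw [max_eq_left hr.le, ← lt_div_iff₀' hr]
    exact (h.resolve_left hr.ne').trans_eq (one_div_mul_eq_div _ _)

theorem exists_forall_ge_of_atTop_inf_ae {p : ℝ → Prop} (hp : ∀ᶠ t in atTop ⊓ ae volume, p t) :
    ∃ T, ∀ᵐ t, T ≤ t → p t := by
  obtain ⟨s, hs, u, hu, hp⟩ := eventually_inf.1 hp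
  obtain ⟨T, hT⟩ := mem_atTop_sets.1 hs
  exact ⟨T, mem_of_superset hu fun t ht hTt => hp t ⟨hT t hTt, ht⟩⟩

theorem eventually_nonneg_iInf {ι : Type*} [Finite ι] {h : ι → ℝ → ℝ}
    (hh : ∀ i, Tendsto (h i) atTop atTop) : ∀ᶠ t in atTop, 0 ≤ ⨅ i, h i t :=
  (eventually_all.2 fun i => (hh i).eventually_ge_atTop 0).mono fun _ ht => Real.iInf_nonneg ht

theorem EssBoundedMeasurable.locallyIntegrableOn {f : ℝ → ℝ} (hf : EssBoundedMeasurable f) :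
    LocallyIntegrableOn f (Ici 0) := by
  obtain ⟨hmeas, C, hC⟩ := hf
  exact locallyIntegrableOn_of_locallyIntegrable_restrict <|
    (locallyIntegrable_const C).mono hmeas.aestronglyMeasurable <|
      hC.mono fun _ ht => ht.trans (le_abs_self C)

theorem isBoundedUnder_sum_div {m : ℕ} {a : ℝ → ℝ} {b : Fin m → ℝ → ℝ} {a₀ : ℝ} (ha₀ : 0 < a₀)
    (haa₀ : ∀ᵐ t ∂(volume.restrict (Ici 0)), a₀ ≤ a t) (hb : ∀ l, EssBoundedMeasurable (b l)) :
    IsBoundedUnder (· ≤ ·) (atTop ⊓ ae volume) (fun t => (∑ l, b l t) / a t) := by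
  choose C hC using fun l => (hb l).2
  have hbound := (ae_all_iff.2 hC).and haa₀
  refine ⟨(∑ l, |C l|) / a₀, eventually_map.2 ?_⟩
  filter_upwards [mem_inf_of_left (Ici_mem_atTop (0 : ℝ)),
    mem_inf_of_right (ae_imp_of_ae_restrict hbound)] with t ht h
  obtain ⟨hbt, hat⟩ := h ht
  exact div_le_div₀ (Finset.sum_nonneg fun l _ => abs_nonneg _)
    (Finset.sum_le_sum fun l _ => ((le_abs_self _).trans (hbt l)).trans (le_abs_self _)) ha₀ hat

theorem corollary1_general {m : ℕ} (hm : 0 < m) (a : ℝ → ℝ) (b h : Fin m → ℝ → ℝ)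
    (K : Fin m → ℝ → ℝ → ℝ) (a₀ : ℝ) (ha₀ : 0 < a₀) (ha : LocallyIntegrableOn a (Ici 0))
    (haa₀ : ∀ᵐ t ∂(volume.restrict (Ici 0)), a₀ ≤ a t)
    (hb : ∀ l, LocallyIntegrableOn (b l) (Ici 0))
    (hb_nonneg : ∀ l, ∀ᵐ t ∂(volume.restrict (Ici 0)), 0 ≤ b l t)
    (hh : ∀ l t, 0 ≤ t → h l t ≤ t) (hh_lim : ∀ l, Tendsto (h l) atTop atTop)
    (hK_nonneg : ∀ l, ∀ᵐ p ∂(volume.restrict (kernelDomain (h l))), 0 ≤ K l p.1 p.2)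
    (hK_one : ∀ l, ∀ᵐ t ∂(volume.restrict (Ici 0)), ∫ s in (h l t)..t, K l t s = 1)
    (h_ratio : IsBoundedUnder (· ≤ ·) (atTop ⊓ ae volume) (fun t => (∑ l, b l t) / a t))
    (h_finite : IsBoundedUnder (· ≤ ·) atTop (delayIntegral a h))
    (h_ineq : limsupRatio a b = 0 ∨
      Real.log ((limsupRatio a b ^ 2 + limsupRatio a b) / (limsupRatio a b ^ 2 + 1)) <
        1 / limsupRatio a b * Real.exp (-limsupDelay a h)) :
    ExponentiallyStable a b h K := by
  obtain ⟨β, H, α, γ, hβ, hH, hα, hα', hγ, hY⟩ :=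
    (yorkeCondition_max_zero h_ineq).exists_perturbation
  obtain ⟨hβ', hβ₀⟩ := max_lt_iff.1 hβ
  obtain ⟨T₁, hratio⟩ := exists_forall_ge_of_atTop_inf_ae (eventually_lt_of_limsup_lt hβ' h_ratio)
  obtain ⟨T₂, hdelay⟩ := eventually_atTop.1
    ((eventually_nonneg_iInf hh_lim).and (eventually_lt_of_limsup_lt hH h_finite))
  refine exponentiallyStable_of_forall_ge hm ha₀ ha haa₀ hb hb_nonneg hh hK_nonneg hK_one
    (T := max 0 (max T₁ T₂)) (le_max_left _ _) hβ₀.le ?_ (fun t ht => ?_) hα hα' hγ hY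
  · filter_upwards [hratio, ae_imp_of_ae_restrict haa₀] with t hrt hat ht
    obtain ⟨ht₀, ht₁, -⟩ := by simpa only [max_le_iff] using ht
    exact ((div_lt_iff₀ (ha₀.trans_le (hat ht₀))).1 (hrt ht₁)).le
  · have ht₂ := ((le_max_right T₁ T₂).trans (le_max_right 0 _)).trans ht
    exact ⟨(hdelay t ht₂).1, (hdelay t ht₂).2.le⟩

theorem corollary1 {m : ℕ} (hm : 0 < m) (a : ℝ → ℝ) (b h : Fin m → ℝ → ℝ)
    (K : Fin m → ℝ → ℝ → ℝ) (a₀ : ℝ) (ha₀ : 0 < a₀)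
    (ha : EssBoundedMeasurable a)
    (haa₀ : ∀ᵐ t ∂(volume.restrict (Ici 0)), a₀ ≤ a t)
    (hb : ∀ l, EssBoundedMeasurable (b l))
    (hb_nonneg : ∀ l, ∀ᵐ t ∂(volume.restrict (Ici 0)), 0 ≤ b l t)
    (hh : ∀ l, IsDelay (h l))
    (hK : ∀ l, IsUnitKernel (h l) (K l))
    (h_finite : IsBoundedUnder (· ≤ ·) atTop (delayIntegral a h))
    (h_ineq : limsupRatio a b = 0 ∨
      Real.log ((limsupRatio a b ^ 2 + limsupRatio a b) / (limsupRatio a b ^ 2 + 1)) <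
        1 / limsupRatio a b * Real.exp (-limsupDelay a h)) :
    ExponentiallyStable a b h K :=
  corollary1_general hm a b h K a₀ ha₀ ha.locallyIntegrableOn haa₀
    (fun l => (hb l).locallyIntegrableOn) hb_nonneg (fun l => (hh l).2.1) (fun l => (hh l).2.2)
    (fun l => (hK l).2.1) (fun l => (hK l).2.2.2) (isBoundedUnder_sum_div ha₀ haa₀ hb) h_finite
    h_ineq
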